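/- For $n,s\ge 1$, $\Gamma\subset\{1,\dots,n\}$ let $B_2^\Gamma$ be the set of vectors $x\in\mathbb R^n$ that vanish outside $\Gamma$ and satisfy $\|x\|_2=1$, and for a complex $n\times n$ matrix $A$ define $$\|A\|_s=\sup_{|\Gamma|\le s,\ x,y\in B_2^\Gamma}|y^*Ax| .$$ There is an absolute constant $C>0$ such that the following holds for all integers $n,m,s\ge 2$ and every real $M$. Let $U$ and $V$ be complex $n\times m$ matrices all of whose entries have absolute value at most $M$, let $\epsilon_1,\dots,\epsilon_m$ be independent random variables, each taking the values $+1$ and $-1$ with probability $1/2$, and let $\Sigma=\operatorname{diag}(\epsilon_1,\dots,\epsilon_m)$. Then $\|U\Sigma V^*\|_s$ is integrable and $$\operatorname{E}\|U\Sigma V^*\|_s\le C\cdot M\cdot s^{1/2}\cdot\log s\cdot\sqrt{\log m\,\log n}\cdot\left(\|VV^*\|_s^{1/2}+\|UU^*\|_s^{1/2}\right),$$ where $^*$ denotes the conjugate transpose. -/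

import Mathlib

open MeasureTheory ProbabilityTheory
open scoped Matrix

/-- `IsRademacher ε P`: the random variables `ε i` on the probability space `(Ω, P)` are independent
and each of them takes the values `1` and `-1` with probability `1/2`. -/
structure IsRademacher {ι Ω : Type*} [MeasurableSpace Ω] (ε : ι → Ω → ℝ) (P : Measure Ω) :
    Prop where
  measurable : ∀ i, Measurable (ε i)
  prob_one : ∀ i, P {ω | ε i ω = 1} = 1 / 2
  prob_neg_one : ∀ i, P {ω | ε i ω = -1} = 1 / 2
  indep : iIndepFun ε P

/-- The set `B₂^Γ` of the real vectors that vanish outside `Γ` and have unit `ℓ²` norm. -/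
def unitVectorsOn {n : ℕ} (Γ : Finset (Fin n)) : Set (EuclideanSpace ℝ (Fin n)) :=
  {x | (∀ j, j ∉ Γ → x j = 0) ∧ ‖x‖ = 1}

/-- A real vector, regarded as a complex one. -/
def complexify {n : ℕ} (x : EuclideanSpace ℝ (Fin n)) : Fin n → ℂ := fun j => (x j : ℂ)

/-- `‖A‖_s`, the supremum of `|y* A x|` over all `Γ` with `|Γ| ≤ s` and all `x, y ∈ B₂^Γ`.
The supremum is over a bounded set, which is non-empty when `n` and `s` are positive. -/
noncomputable def sparseNorm {n : ℕ} (s : ℕ) (A : Matrix (Fin n) (Fin n) ℂ) : ℝ :=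
  sSup {r : ℝ | ∃ Γ : Finset (Fin n), Γ.card ≤ s ∧
    ∃ x ∈ unitVectorsOn Γ, ∃ y ∈ unitVectorsOn Γ,
      r = ‖star (complexify y) ⬝ᵥ (A *ᵥ complexify x)‖}

/-- The diagonal matrix with diagonal entries `a i`. -/
def signMatrix {m : ℕ} (a : Fin m → ℝ) : Matrix (Fin m) (Fin m) ℂ :=
  Matrix.diagonal fun i => (a i : ℂ)

/-! ### A maximal inequality for Rademacher sums -/

section Rademacher

variable {Ω ι : Type*} [MeasurableSpace Ω] {P : Measure Ω} {ε : ι → Ω → ℝ}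

/-! Writing u_i(y) and v_i(x) for the column forms of U and V, y*UΣV*x is the Rademacher sum ∑ ε_i
u_i(y) conj(v_i(x)), and its supremum over pairs of sparse unit vectors is bounded by chaining. If
the forms move by at most δ in sup norm, the coefficient vector moves by at most 2δ(a + b) in ℓ²,
where a² = ‖VV*‖_s and b² = ‖UU*‖_s (`sum_norm_mul_star_sub_sq_le`). Hence coverings in the sup norm
of the column forms are enough.

Such coverings come from Maurey's method (`exists_average_columnForms`). A sparse unit vector has ℓ¹
norm at most R = √s, so an average of k random vertices ±R e_j approximates it with error of order M
R √(log m / k). Mesh M R / 2^l therefore has entropy of order 4^l log m log n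
(`exists_projections_columnForms`). The maximal inequality `IsRademacher.exists_dominating` turns
each scale into a contribution of order M √s (a + b) √(log m log n), the same for every l. After
about log s scales the mesh is at most of order M, and the entropy s log n of a finite net of sparse
vectors finishes the chain (`IsRademacher.exists_dominating_pairs`). The number of scales is the
factor log s. -/

lemma IsRademacher.ae_eq [IsProbabilityMeasure P] (h : IsRademacher ε P) (i : ι) :
    ∀ᵐ ω ∂P, ε i ω = 1 ∨ ε i ω = -1 := by
  have h1 : MeasurableSet {ω | ε i ω = 1} := h.measurable i (measurableSet_singleton 1)
  have h2 : MeasurableSet {ω | ε i ω = -1} := h.measurable i (measurableSet_singleton (-1))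
  have hd : Disjoint {ω | ε i ω = 1} {ω | ε i ω = -1} := by
    rw [Set.disjoint_left]
    intro ω ha hb
    simp only [Set.mem_ofPred_eq] at ha hb
    linarith
  have hu : P ({ω | ε i ω = 1} ∪ {ω | ε i ω = -1}) = 1 := by
    rw [measure_union hd h2, h.prob_one, h.prob_neg_one, ENNReal.add_halves]
  exact (mem_ae_iff_prob_eq_one (h1.union h2)).2 hu

lemma IsRademacher.integral_eq_zero [IsProbabilityMeasure P] (h : IsRademacher ε P) (i : ι) :
    ∫ ω, ε i ω ∂P = 0 := by
  have h1 : MeasurableSet {ω | ε i ω = 1} := h.measurable i (measurableSet_singleton 1)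
  have h2 : MeasurableSet {ω | ε i ω = -1} := h.measurable i (measurableSet_singleton (-1))
  have : ε i =ᵐ[P] fun ω => Set.indicator {ω | ε i ω = 1} (fun _ => (1 : ℝ)) ω
      - Set.indicator {ω | ε i ω = -1} (fun _ => (1 : ℝ)) ω := by
    filter_upwards [h.ae_eq i] with ω hω
    rcases hω with hω | hω <;> norm_num [Set.indicator, hω]
  rw [integral_congr_ae this, integral_sub, integral_indicator_const _ h1,
    integral_indicator_const _ h2]
  · simp [Measure.real, h.prob_one, h.prob_neg_one]
  · exact (integrable_const _).indicator h1
  · exact (integrable_const _).indicator h2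

lemma IsRademacher.hasSubgaussianMGF_sum [Fintype ι] [IsProbabilityMeasure P]
    (h : IsRademacher ε P) (c : ι → ℝ) :
    HasSubgaussianMGF (fun ω => ∑ i, c i * ε i ω) (∑ i, ‖c i‖₊ ^ 2) P := by
  refine HasSubgaussianMGF.sum_of_iIndepFun (X := fun i ω => c i * ε i ω)
    (h.indep.comp (fun i x => c i * x) (fun i => measurable_const_mul _)) (fun i _ => ?_)
  have := hasSubgaussianMGF_of_mem_Icc_of_integral_eq_zero (μ := P)
    (X := fun ω => c i * ε i ω) (a := -|c i|) (b := |c i|)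
    ((h.measurable i).const_mul _).aemeasurable ?_ ?_
  · convert this using 2
    rw [sub_neg_eq_add, ← two_mul, nnnorm_mul]
    simp
  · filter_upwards [h.ae_eq i] with ω hω
    rcases hω with hω | hω
    · simp [hω, neg_abs_le, le_abs_self]
    · simp [hω, neg_le_abs, abs_le.1 le_rfl]
  · rw [integral_const_mul, h.integral_eq_zero, mul_zero]

/-- A maximal inequality: finitely many Rademacher sums with real coefficients are dominated
together by an integrable random variable of small mean. -/
lemma IsRademacher.exists_dominating_real [Fintype ι] [IsProbabilityMeasure P]
    (h : IsRademacher ε P) (S : Finset (ι → ℝ)) {σ H : ℝ} (hσ : 0 ≤ σ) (hH : 1 ≤ H)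
    (hS : (S.card : ℝ) ≤ Real.exp H) (hc : ∀ c ∈ S, ∑ i, c i ^ 2 ≤ σ ^ 2) :
    ∃ Y : Ω → ℝ, Integrable Y P ∧ ∫ ω, Y ω ∂P ≤ 3 * σ * √H ∧
      ∀ ω, ∀ c ∈ S, |∑ i, c i * ε i ω| ≤ Y ω := by
  rcases hσ.eq_or_lt with rfl | hσ
  · refine ⟨fun _ => 0, integrable_zero _ _ _, by simp, fun ω c hcS => ?_⟩
    have h0 : ∑ i, c i ^ 2 = 0 := le_antisymm (by simpa using hc c hcS)
      (Finset.sum_nonneg fun i _ => sq_nonneg _)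
    rw [Finset.sum_eq_zero_iff_of_nonneg (fun i _ => sq_nonneg _)] at h0
    have : ∀ i, c i = 0 := fun i => by simpa using h0 i (Finset.mem_univ i)
    simp [this]
  have hs : 0 < √(2 * H) := Real.sqrt_pos.2 (by linarith)
  have hss : √(2 * H) ^ 2 = 2 * H := Real.sq_sqrt (by linarith)
  -- This parameter gives σ²l²/2 = H, so each exponential moment is at most e^H, the same as the
  -- bound on the number of sums.
  set l : ℝ := √(2 * H) / σ with hl
  have hl0 : 0 < l := div_pos hs hσ
  have hlσ : l * σ = √(2 * H) := div_mul_cancel₀ _ hσ.ne'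
  let Z : (ι → ℝ) → Ω → ℝ := fun c ω => ∑ i, c i * ε i ω
  have hZ : ∀ c, HasSubgaussianMGF (Z c) (∑ i, ‖c i‖₊ ^ 2) P := h.hasSubgaussianMGF_sum
  have hint : ∀ c t, Integrable (fun ω => Real.exp (t * Z c ω)) P :=
    fun c t => (hZ c).integrable_exp_mul t
  have hmgf : ∀ c ∈ S, ∀ t, t ^ 2 = l ^ 2 → ∫ ω, Real.exp (t * Z c ω) ∂P ≤ Real.exp H := by
    intro c hcS t ht
    refine ((hZ c).mgf_le t).trans (Real.exp_le_exp.2 ?_)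
    have : ((∑ i, ‖c i‖₊ ^ 2 : NNReal) : ℝ) = ∑ i, c i ^ 2 := by simp
    rw [this, ht]
    have := mul_le_mul_of_nonneg_right (hc c hcS) (sq_nonneg l)
    have h2 : σ ^ 2 * l ^ 2 = 2 * H := by rw [← mul_pow, mul_comm, hlσ, hss]
    linarith
  let W : Ω → ℝ := fun ω => ∑ c ∈ S, (Real.exp (l * Z c ω) + Real.exp (-l * Z c ω))
  have hWint : Integrable W P :=
    integrable_finsetSum _ fun c _ => (hint c l).add (hint c (-l))
  have hWle : ∫ ω, W ω ∂P ≤ 2 * Real.exp (2 * H) := by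
    have : ∫ ω, W ω ∂P = ∑ c ∈ S, ∫ ω, (Real.exp (l * Z c ω) + Real.exp (-l * Z c ω)) ∂P :=
      integral_finsetSum _ fun c _ => (hint c l).add (hint c (-l))
    rw [this]
    calc _ ≤ ∑ c ∈ S, 2 * Real.exp H := by
          refine Finset.sum_le_sum fun c hcS => ?_
          rw [integral_add (hint c l) (hint c (-l))]
          have h1 := hmgf c hcS l rfl
          have h2 := hmgf c hcS (-l) (neg_sq l)
          linarith
      _ = S.card * (2 * Real.exp H) := by simp
      _ ≤ Real.exp H * (2 * Real.exp H) := by gcongr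
      _ = _ := by rw [two_mul H, Real.exp_add]; ring
  -- A tangent line replaces log W: from 1 + t ≤ e^t with t = l|Z| - 2H, l|Z| is below the
  -- numerator. The mean is at most (2H + 2)/l ≤ 4H/l = 2√2 σ√H.
  refine ⟨fun ω => (2 * H + Real.exp (-(2 * H)) * W ω) / l, ?_, ?_, ?_⟩
  · exact ((integrable_const _).add (hWint.const_mul _)).div_const _
  · rw [integral_div, integral_add (integrable_const _) (hWint.const_mul _),
      integral_const_mul (Real.exp _)]
    simp only [integral_const, probReal_univ, one_smul]
    have h1 : Real.exp (-(2 * H)) * ∫ ω, W ω ∂P ≤ 2 := by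
      calc _ ≤ Real.exp (-(2 * H)) * (2 * Real.exp (2 * H)) := by gcongr
        _ = 2 := by rw [mul_left_comm, ← Real.exp_add]; simp
    rw [div_le_iff₀ hl0]
    have h2 : 3 * σ * √H * l = 3 * √2 * H := by
      have : √(2 * H) = √2 * √H := Real.sqrt_mul (by norm_num) _
      calc 3 * σ * √H * l = 3 * √H * (l * σ) := by ring
        _ = 3 * √2 * (√H * √H) := by rw [hlσ, this]; ring
        _ = _ := by rw [Real.mul_self_sqrt (by linarith)]
    have h3 : (4 / 3 : ℝ) ≤ √2 := Real.le_sqrt_of_sq_le (by norm_num)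
    rw [h2]
    nlinarith
  · intro ω c hcS
    rw [le_div_iff₀ hl0]
    have h1 : Real.exp (l * |Z c ω|) ≤ W ω := by
      refine le_trans ?_ (Finset.single_le_sum (f := fun c =>
        Real.exp (l * Z c ω) + Real.exp (-l * Z c ω)) (fun c _ => by positivity) hcS)
      rcases abs_choice (Z c ω) with h | h <;> rw [h]
      · exact le_add_of_nonneg_right (Real.exp_pos _).le
      · rw [mul_neg, ← neg_mul]
        exact le_add_of_nonneg_left (Real.exp_pos _).le
    have h2 := Real.add_one_le_exp (l * |Z c ω| - 2 * H)
    have h3 : Real.exp (l * |Z c ω| - 2 * H) ≤ Real.exp (-(2 * H)) * W ω := by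
      rw [sub_eq_neg_add, Real.exp_add]
      gcongr
    have h4 : |∑ i, c i * ε i ω| * l = l * |Z c ω| := mul_comm _ _
    rw [h4]
    linarith

/-- A maximal inequality: finitely many Rademacher sums with complex coefficients are dominated
together by an integrable random variable of small mean. -/
lemma IsRademacher.exists_dominating [Fintype ι] [IsProbabilityMeasure P]
    (h : IsRademacher ε P) (S : Finset (ι → ℂ)) {σ H : ℝ} (hσ : 0 ≤ σ) (hH : 1 ≤ H)
    (hS : (S.card : ℝ) ≤ Real.exp H) (hc : ∀ c ∈ S, ∑ i, ‖c i‖ ^ 2 ≤ σ ^ 2) :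
    ∃ Y : Ω → ℝ, Integrable Y P ∧ ∫ ω, Y ω ∂P ≤ 6 * σ * √H ∧
      ∀ ω, ∀ c ∈ S, ‖∑ i, c i * (ε i ω : ℂ)‖ ≤ Y ω := by
  classical
  have key : ∀ f : ℂ → ℝ, (∀ z, f z ^ 2 ≤ ‖z‖ ^ 2) →
      ∃ Y : Ω → ℝ, Integrable Y P ∧ ∫ ω, Y ω ∂P ≤ 3 * σ * √H ∧
        ∀ ω, ∀ c ∈ S, |∑ i, f (c i) * ε i ω| ≤ Y ω := by
    intro f hf
    obtain ⟨Y, hY1, hY2, hY3⟩ := h.exists_dominating_real (S.image fun c i => f (c i)) hσ hH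
      ((Nat.cast_le.2 Finset.card_image_le).trans hS) (by
        intro c hcS
        obtain ⟨d, hd, rfl⟩ := Finset.mem_image.1 hcS
        exact (Finset.sum_le_sum fun i _ => hf _).trans (hc d hd))
    exact ⟨Y, hY1, hY2, fun ω c hcS => hY3 ω _ (Finset.mem_image_of_mem _ hcS)⟩
  obtain ⟨Y, hY1, hY2, hY3⟩ := key Complex.re fun z => by
    rw [← sq_abs]; gcongr; exact Complex.abs_re_le_norm z
  obtain ⟨Z, hZ1, hZ2, hZ3⟩ := key Complex.im fun z => by
    rw [← sq_abs]; gcongr; exact Complex.abs_im_le_norm z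
  refine ⟨fun ω => Y ω + Z ω, hY1.add hZ1, ?_, fun ω c hcS => ?_⟩
  · rw [integral_add hY1 hZ1]; linarith
  · refine (Complex.norm_le_abs_re_add_abs_im _).trans (add_le_add ?_ ?_)
    · simpa using hY3 ω c hcS
    · simpa using hZ3 ω c hcS

/-- A function of finitely many Rademacher variables is integrable. -/
lemma IsRademacher.integrable_comp [Fintype ι] [IsProbabilityMeasure P]
    (h : IsRademacher ε P) (F : (ι → ℝ) → ℝ) : Integrable (fun ω => F fun i => ε i ω) P := by
  classical
  -- Almost surely the signs factor through the finite type `ι → Bool`, where every function is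
  -- bounded and measurable; hence `F` can be arbitrary.
  let b : Ω → ι → Bool := fun ω i => decide (ε i ω = 1)
  have hb : Measurable b := by
    refine measurable_pi_lambda _ fun i => ?_
    refine measurable_to_bool ?_
    have : (fun ω => b ω i) ⁻¹' {true} = {ω | ε i ω = 1} := by ext; simp [b]
    rw [this]
    exact h.measurable i (measurableSet_singleton 1)
  let G : (ι → Bool) → ℝ := fun β => F fun i => if β i then 1 else -1
  have hG : Integrable (fun ω => G (b ω)) P := by
    refine Integrable.of_bound (C := ∑ β, ‖G β‖)
      ((measurable_of_finite G).comp hb).aestronglyMeasurable (Filter.Eventually.of_forall ?_)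
    exact fun ω => Finset.single_le_sum (f := fun β => ‖G β‖) (fun _ _ => norm_nonneg _)
      (Finset.mem_univ (b ω))
  refine hG.congr ?_
  filter_upwards [ae_all_iff.2 h.ae_eq] with ω hω
  refine congrArg F (funext fun i => ?_)
  rcases hω i with hi | hi <;> norm_num [b, hi]

end Rademacher

/-! ### Maurey's empirical method -/

section Sampling

/-- Convexity puts the exponential below its chord on [-lB, lB]. The chord is affine in `d`, so its
sinh term vanishes on averaging a mean-zero `d`. -/
lemma exp_mul_le_cosh_add {B d : ℝ} (hB : 0 < B) (hd : |d| ≤ B) (l : ℝ) :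
    Real.exp (l * d) ≤ Real.cosh (l * B) + d / B * Real.sinh (l * B) := by
  obtain ⟨h1, h2⟩ := abs_le.1 hd
  have h3 : d / B ≤ 1 := (div_le_one hB).2 h2
  have h4 : -1 ≤ d / B := by rw [le_div_iff₀ hB]; linarith
  have := convexOn_exp.2 (Set.mem_univ (l * B)) (Set.mem_univ (-(l * B)))
    (show 0 ≤ (1 + d / B) / 2 by linarith) (show 0 ≤ (1 - d / B) / 2 by linarith) (by ring)
  simp only [smul_eq_mul] at this
  have e : (1 + d / B) / 2 * (l * B) + (1 - d / B) / 2 * -(l * B) = l * d := by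
    field_simp; ring
  rw [e] at this
  rw [Real.cosh_eq, Real.sinh_eq]
  linarith

variable {V I : Type*} [Fintype V] [Fintype I] {w : V → ℝ} {D : I → V → ℝ} {B : ℝ}

/-- A derandomised Hoeffding bound: points are added one at a time. The `w`-average of the new
exponential sum grows by at most exp((lB)²/2), so some choice of the next point does no worse than
the average. -/
lemma exists_sum_exp_le (hw : ∀ v, 0 ≤ w v) (hw1 : ∑ v, w v = 1) (hB : 0 < B)
    (hD : ∀ i v, |D i v| ≤ B) (hD0 : ∀ i, ∑ v, w v * D i v = 0) (l : ℝ) (k : ℕ) :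
    ∃ f : Fin k → V, ∑ i, Real.exp (l * ∑ a, D i (f a)) ≤
      Fintype.card I * Real.exp (k * ((l * B) ^ 2 / 2)) := by
  induction k with
  | zero => exact ⟨Fin.elim0, by simp⟩
  | succ k ih =>
    obtain ⟨f, hf⟩ := ih
    set q : I → ℝ := fun i => Real.exp (l * ∑ a, D i (f a))
    have hmean : ∑ v, w v * ∑ i, q i * Real.exp (l * D i v) ≤
        Real.exp ((l * B) ^ 2 / 2) * ∑ i, q i := by
      simp only [Finset.mul_sum]
      rw [Finset.sum_comm]
      refine Finset.sum_le_sum fun i _ => ?_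
      calc ∑ v, w v * (q i * Real.exp (l * D i v))
          ≤ ∑ v, w v * (q i * (Real.cosh (l * B) + D i v / B * Real.sinh (l * B))) := by
            refine Finset.sum_le_sum fun v _ => ?_
            exact mul_le_mul_of_nonneg_left (mul_le_mul_of_nonneg_left
              (exp_mul_le_cosh_add hB (hD i v) l) (Real.exp_pos _).le) (hw v)
        _ = q i * Real.cosh (l * B) * ∑ v, w v
            + q i * (Real.sinh (l * B) / B) * ∑ v, w v * D i v := by
            rw [Finset.mul_sum, Finset.mul_sum, ← Finset.sum_add_distrib]
            exact Finset.sum_congr rfl fun v _ => by ring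
        _ = Real.cosh (l * B) * q i := by rw [hw1, hD0]; ring
        _ ≤ _ := mul_le_mul_of_nonneg_right (Real.cosh_le_exp_half_sq _) (Real.exp_pos _).le
    obtain ⟨v, hv⟩ : ∃ v, ∑ i, q i * Real.exp (l * D i v) ≤
        Real.exp ((l * B) ^ 2 / 2) * ∑ i, q i := by
      by_contra! hcon
      obtain ⟨v₀, hv₀⟩ : ∃ v, 0 < w v := by
        by_contra! h0
        have : ∑ v, w v ≤ 0 := Finset.sum_nonpos fun v _ => h0 v
        linarith
      have : ∑ v, w v * (Real.exp ((l * B) ^ 2 / 2) * ∑ i, q i) <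
          ∑ v, w v * ∑ i, q i * Real.exp (l * D i v) :=
        Finset.sum_lt_sum (fun v _ => mul_le_mul_of_nonneg_left (hcon v).le (hw v))
          ⟨v₀, Finset.mem_univ _, mul_lt_mul_of_pos_left (hcon v₀) hv₀⟩
      rw [← Finset.sum_mul, hw1, one_mul] at this
      linarith
    refine ⟨Fin.cons v f, ?_⟩
    calc ∑ i, Real.exp (l * ∑ a, D i ((Fin.cons v f : Fin (k + 1) → V) a))
        = ∑ i, q i * Real.exp (l * D i v) := by
          refine Finset.sum_congr rfl fun i _ => ?_
          rw [Fin.sum_univ_succ]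
          simp only [Fin.cons_zero, Fin.cons_succ]
          rw [mul_add, Real.exp_add, mul_comm]
      _ ≤ Real.exp ((l * B) ^ 2 / 2) * (Fintype.card I * Real.exp (k * ((l * B) ^ 2 / 2))) :=
          hv.trans (mul_le_mul_of_nonneg_left hf (Real.exp_pos _).le)
      _ = _ := by
          rw [mul_left_comm, ← Real.exp_add]
          push_cast
          ring_nf

/-- Sampling: given finitely many bounded functionals of mean zero, some `k` points have
all the empirical sums as small as Hoeffding's inequality predicts. -/
lemma exists_sampling (hw : ∀ v, 0 ≤ w v) (hw1 : ∑ v, w v = 1) (hB : 0 ≤ B)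
    (hD : ∀ i v, |D i v| ≤ B) (hD0 : ∀ i, ∑ v, w v * D i v = 0) {k : ℕ} (hk : 0 < k)
    {H : ℝ} (hH : 0 < H) (hI : (Fintype.card I : ℝ) ≤ Real.exp H) :
    ∃ f : Fin k → V, ∀ i, ∑ a, D i (f a) ≤ B * √(2 * k * H) := by
  rcases hB.eq_or_lt with rfl | hB
  · obtain ⟨v⟩ : Nonempty V := by
      by_contra h
      rw [not_nonempty_iff] at h
      simp at hw1
    refine ⟨fun _ => v, fun i => ?_⟩
    have : D i v = 0 := abs_nonpos_iff.1 (hD i v)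
    simp [this]
  have hk' : (0 : ℝ) < k := Nat.cast_pos.2 hk
  set r : ℝ := √(2 * k * H) with hr
  have hr0 : 0 < r := Real.sqrt_pos.2 (by positivity)
  have hr2 : r ^ 2 = 2 * k * H := Real.sq_sqrt (by positivity)
  -- The optimal Hoeffding parameter: it makes k(lB)²/2 equal to H.
  set l : ℝ := r / (k * B) with hl
  have hl0 : 0 < l := by positivity
  obtain ⟨f, hf⟩ := exists_sum_exp_le hw hw1 hB hD hD0 l k
  refine ⟨f, fun i => ?_⟩
  have h1 : Real.exp (l * ∑ a, D i (f a)) ≤ Real.exp (H + k * ((l * B) ^ 2 / 2)) := by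
    refine (Finset.single_le_sum (f := fun i => Real.exp (l * ∑ a, D i (f a)))
      (fun _ _ => (Real.exp_pos _).le) (Finset.mem_univ i)).trans (hf.trans ?_)
    rw [Real.exp_add]
    gcongr
  have h2 := Real.exp_le_exp.1 h1
  have h3 : k * ((l * B) ^ 2 / 2) = H := by
    have : l * B = r / k := by rw [hl]; field_simp
    rw [this, div_pow, hr2]; field_simp
  rw [h3] at h2
  have h4 : l * (B * r) = H + H := by
    have : l * (B * r) = r ^ 2 / k := by rw [hl]; field_simp
    rw [this, hr2]; field_simp; ring
  exact le_of_mul_le_mul_left (by rw [h4]; exact h2) hl0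

end Sampling

/-! ### Linear forms given by the columns of a matrix -/

section ColumnForms

variable {n m : ℕ}

/-- The values at `x` of the linear forms given by the columns of `A`. -/
noncomputable def columnForms (A : Matrix (Fin n) (Fin m) ℂ) (x : EuclideanSpace ℝ (Fin n)) :
    Fin m → ℂ :=
  fun i => ∑ j, (x j : ℂ) * A j i

lemma columnForms_zero (A : Matrix (Fin n) (Fin m) ℂ) : columnForms A 0 = 0 := by
  ext i; simp [columnForms]

lemma norm_columnForms_le {A : Matrix (Fin n) (Fin m) ℂ} {M : ℝ} (hA : ∀ j i, ‖A j i‖ ≤ M)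
    (x : EuclideanSpace ℝ (Fin n)) (i : Fin m) :
    ‖columnForms A x i‖ ≤ M * ∑ j, |x j| := by
  rw [Finset.mul_sum]
  refine (norm_sum_le _ _).trans (Finset.sum_le_sum fun j _ => ?_)
  rw [norm_mul, Complex.norm_real, Real.norm_eq_abs, mul_comm]
  exact mul_le_mul_of_nonneg_right (hA j i) (abs_nonneg _)

lemma dotProduct_mul_signMatrix_mulVec (U V : Matrix (Fin n) (Fin m) ℂ) (a : Fin m → ℝ)
    (x y : EuclideanSpace ℝ (Fin n)) :
    star (complexify y) ⬝ᵥ ((U * signMatrix a * Vᴴ) *ᵥ complexify x) =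
      ∑ i, columnForms U y i * star (columnForms V x i) * (a i : ℂ) := by
  rw [← Matrix.mulVec_mulVec, Matrix.dotProduct_mulVec, ← Matrix.vecMul_vecMul]
  refine Finset.sum_congr rfl fun i _ => ?_
  have h1 : (Vᴴ *ᵥ complexify x) i = star (columnForms V x i) := by
    simp [Matrix.mulVec, dotProduct, columnForms, complexify, mul_comm]
  have h2 : (star (complexify y) ᵥ* U) i = columnForms U y i := by
    simp [Matrix.vecMul, dotProduct, columnForms, complexify]
  rw [h1, signMatrix, Matrix.vecMul_diagonal, h2]
  ring

lemma dotProduct_mul_conjTranspose_mulVec (V : Matrix (Fin n) (Fin m) ℂ)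
    (x : EuclideanSpace ℝ (Fin n)) :
    star (complexify x) ⬝ᵥ ((V * Vᴴ) *ᵥ complexify x) =
      ((∑ i, ‖columnForms V x i‖ ^ 2 : ℝ) : ℂ) := by
  have := dotProduct_mul_signMatrix_mulVec V V (fun _ => 1) x x
  have h1 : signMatrix (fun _ : Fin m => (1 : ℝ)) = 1 := by simp [signMatrix]
  rw [h1, Matrix.mul_one] at this
  rw [this]
  push_cast
  refine Finset.sum_congr rfl fun i _ => ?_
  rw [Complex.star_def, Complex.mul_conj']
  simp

end ColumnForms

/-! ### The norm on sparse vectors -/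

section SparseNorm

variable {n : ℕ}

lemma complexify_smul (c : ℝ) (x : EuclideanSpace ℝ (Fin n)) :
    complexify (c • x) = (c : ℂ) • complexify x := by
  ext j; simp [complexify]

lemma complexify_sub (x y : EuclideanSpace ℝ (Fin n)) :
    complexify (x - y) = complexify x - complexify y := by
  ext j; simp [complexify]

lemma norm_apply_le (x : EuclideanSpace ℝ (Fin n)) (j : Fin n) : |x j| ≤ ‖x‖ := by
  simpa using PiLp.norm_apply_le x j

lemma bddAbove_sparseNorm (s : ℕ) (A : Matrix (Fin n) (Fin n) ℂ) :
    BddAbove {r : ℝ | ∃ Γ : Finset (Fin n), Γ.card ≤ s ∧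
      ∃ x ∈ unitVectorsOn Γ, ∃ y ∈ unitVectorsOn Γ,
        r = ‖star (complexify y) ⬝ᵥ (A *ᵥ complexify x)‖} := by
  refine ⟨∑ j, ∑ k, ‖A j k‖, ?_⟩
  rintro r ⟨Γ, -, x, hx, y, hy, rfl⟩
  have hb : ∀ z ∈ unitVectorsOn Γ, ∀ j, ‖complexify z j‖ ≤ 1 := fun z hz j => by
    simpa [complexify, ← hz.2] using norm_apply_le z j
  simp only [dotProduct, Matrix.mulVec, Finset.mul_sum]
  refine (norm_sum_le _ _).trans (Finset.sum_le_sum fun j _ =>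
    (norm_sum_le _ _).trans (Finset.sum_le_sum fun k _ => ?_))
  rw [norm_mul, norm_mul, Pi.star_apply, norm_star]
  have h1 := hb x hx k
  have h2 := hb y hy j
  calc _ ≤ 1 * (‖A j k‖ * 1) := by gcongr
    _ = _ := by ring

lemma sparseNorm_nonneg (s : ℕ) (A : Matrix (Fin n) (Fin n) ℂ) : 0 ≤ sparseNorm s A := by
  refine Real.sSup_nonneg ?_
  rintro r ⟨Γ, -, x, -, y, -, rfl⟩
  exact norm_nonneg _

lemma norm_dotProduct_mulVec_le_sparseNorm {s : ℕ} (A : Matrix (Fin n) (Fin n) ℂ)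
    {Γ : Finset (Fin n)} (hΓ : Γ.card ≤ s) {x y : EuclideanSpace ℝ (Fin n)}
    (hx : ∀ j ∉ Γ, x j = 0) (hy : ∀ j ∉ Γ, y j = 0) :
    ‖star (complexify y) ⬝ᵥ (A *ᵥ complexify x)‖ ≤ sparseNorm s A * ‖x‖ * ‖y‖ := by
  have key : ∀ z : EuclideanSpace ℝ (Fin n), (∀ j ∉ Γ, z j = 0) → z ≠ 0 →
      ∃ u ∈ unitVectorsOn Γ, z = ‖z‖ • u := by
    intro z hz hz0
    refine ⟨‖z‖⁻¹ • z, ⟨fun j hj => by simp [hz j hj], ?_⟩, ?_⟩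
    · rw [norm_smul, norm_inv, norm_norm, inv_mul_cancel₀ (norm_ne_zero_iff.2 hz0)]
    · rw [smul_smul, mul_inv_cancel₀ (norm_ne_zero_iff.2 hz0), one_smul]
  have hzero : complexify (0 : EuclideanSpace ℝ (Fin n)) = 0 := by ext; simp [complexify]
  by_cases hx0 : x = 0
  · simp [hx0, hzero]
  by_cases hy0 : y = 0
  · simp [hy0, hzero]
  obtain ⟨u, hu, hxu⟩ := key x hx hx0
  obtain ⟨v, hv, hyv⟩ := key y hy hy0
  have h1 : ‖star (complexify v) ⬝ᵥ (A *ᵥ complexify u)‖ ≤ sparseNorm s A :=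
    le_csSup (bddAbove_sparseNorm s A) ⟨Γ, hΓ, u, hu, v, hv, rfl⟩
  have h2 : star (complexify y) ⬝ᵥ (A *ᵥ complexify x) =
      (‖y‖ : ℂ) * ((‖x‖ : ℂ) * (star (complexify v) ⬝ᵥ (A *ᵥ complexify u))) := by
    conv_lhs => rw [hxu, hyv, complexify_smul, complexify_smul]
    simp [Matrix.mulVec_smul, mul_left_comm]
  rw [h2, norm_mul, norm_mul, Complex.norm_real, Complex.norm_real, norm_norm, norm_norm]
  calc _ ≤ ‖y‖ * (‖x‖ * sparseNorm s A) := by gcongr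
    _ = _ := by ring

/-- The sum is the quadratic form of VV* at `x`. This is where the two norms on the right of the
theorem enter. -/
lemma sum_norm_columnForms_sq_le {m s : ℕ} (V : Matrix (Fin n) (Fin m) ℂ)
    {Γ : Finset (Fin n)} (hΓ : Γ.card ≤ s) {x : EuclideanSpace ℝ (Fin n)}
    (hx : ∀ j ∉ Γ, x j = 0) (hx1 : ‖x‖ ≤ 1) :
    ∑ i, ‖columnForms V x i‖ ^ 2 ≤ sparseNorm s (V * Vᴴ) := by
  have h := norm_dotProduct_mulVec_le_sparseNorm (V * Vᴴ) hΓ hx hx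
  rw [dotProduct_mul_conjTranspose_mulVec, Complex.norm_real, Real.norm_eq_abs] at h
  have h0 := sparseNorm_nonneg s (V * Vᴴ)
  calc _ ≤ sparseNorm s (V * Vᴴ) * ‖x‖ * ‖x‖ := (le_abs_self _).trans h
    _ ≤ sparseNorm s (V * Vᴴ) * 1 * 1 := by gcongr
    _ = _ := by ring

lemma sparseNorm_min (s : ℕ) (A : Matrix (Fin n) (Fin n) ℂ) :
    sparseNorm (min s n) A = sparseNorm s A := by
  have : ∀ Γ : Finset (Fin n), Γ.card ≤ min s n ↔ Γ.card ≤ s := fun Γ => by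
    have := card_finset_fin_le Γ
    omega
  simp only [sparseNorm, this]

/-- The norm on sparse vectors is controlled by a `1 / 4`-net. -/
lemma sparseNorm_le_of_net {s : ℕ} (A : Matrix (Fin n) (Fin n) ℂ)
    {T : Set (EuclideanSpace ℝ (Fin n))} (hT1 : ∀ z ∈ T, ‖z‖ ≤ 1)
    (hT : ∀ Γ : Finset (Fin n), Γ.card ≤ s → ∀ x ∈ unitVectorsOn Γ,
      ∃ z ∈ T, (∀ j ∉ Γ, z j = 0) ∧ ‖x - z‖ ≤ 1 / 4)
    {b : ℝ} (hb0 : 0 ≤ b)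
    (hb : ∀ x ∈ T, ∀ y ∈ T, ‖star (complexify y) ⬝ᵥ (A *ᵥ complexify x)‖ ≤ b) :
    sparseNorm s A ≤ 2 * b := by
  have h0 := sparseNorm_nonneg s A
  -- The error terms are again forms in vectors supported in the same Γ, so each costs a quarter of
  -- the norm itself and can be absorbed, the norm being finite.
  suffices h : sparseNorm s A ≤ b + sparseNorm s A / 2 by linarith
  refine Real.sSup_le ?_ (by linarith)
  rintro r ⟨Γ, hΓ, x, hx, y, hy, rfl⟩
  obtain ⟨z, hz, hzΓ, hxz⟩ := hT Γ hΓ x hx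
  obtain ⟨w, hw, hwΓ, hyw⟩ := hT Γ hΓ y hy
  have e : star (complexify y) ⬝ᵥ (A *ᵥ complexify x) =
      star (complexify w) ⬝ᵥ (A *ᵥ complexify z)
      + star (complexify w) ⬝ᵥ (A *ᵥ complexify (x - z))
      + star (complexify (y - w)) ⬝ᵥ (A *ᵥ complexify x) := by
    simp only [complexify_sub, star_sub, Matrix.mulVec_sub, dotProduct_sub, sub_dotProduct]
    ring
  have h1 := norm_dotProduct_mulVec_le_sparseNorm A hΓ (x := x - z) (y := w)
    (fun j hj => by simp [hx.1 j hj, hzΓ j hj]) hwΓ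
  have h2 := norm_dotProduct_mulVec_le_sparseNorm A hΓ (x := x) (y := y - w) hx.1
    (fun j hj => by simp [hy.1 j hj, hwΓ j hj])
  have h3 : sparseNorm s A * ‖x - z‖ * ‖w‖ ≤ sparseNorm s A * (1 / 4) * 1 := by
    have := hT1 w hw
    gcongr
  have h4 : sparseNorm s A * ‖x‖ * ‖y - w‖ ≤ sparseNorm s A * 1 * (1 / 4) := by
    rw [hx.2]
    gcongr
  rw [e]
  refine (norm_add₃_le).trans ?_
  have := hb z hz w hw
  linarith

end SparseNorm

/-! ### Nets of sparse vectors -/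

section Nets

variable {n m : ℕ}

/-- Rounding towards zero: it creates no new support and does not increase the norm. -/
lemma exists_int_abs_le_abs_sub_le (a : ℝ) : ∃ t : ℤ, |(t : ℝ)| ≤ |a| ∧ |a - t| ≤ 1 := by
  rcases le_total 0 a with h | h
  · refine ⟨⌊a⌋, ?_, ?_⟩
    · rw [abs_of_nonneg h, abs_of_nonneg (by exact_mod_cast Int.floor_nonneg.2 h)]
      exact Int.floor_le a
    · rw [abs_of_nonneg (sub_nonneg.2 (Int.floor_le a))]
      linarith [Int.lt_floor_add_one a]
  · refine ⟨⌈a⌉, ?_, ?_⟩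
    · rw [abs_of_nonpos h, abs_of_nonpos (by exact_mod_cast Int.ceil_nonpos.2 h)]
      linarith [Int.le_ceil a]
    · rw [abs_of_nonpos (sub_nonpos.2 (Int.le_ceil a))]
      linarith [Int.ceil_lt_add_one a]

/-- The `s`-sparse vectors of the unit ball have a small net of `s`-sparse vectors, in which a
vector is approximated within its own support. -/
lemma exists_sparse_net {s : ℕ} (hs : 1 ≤ s) (hsn : s ≤ n) :
    ∃ T : Finset (EuclideanSpace ℝ (Fin n)), 0 ∈ T ∧
      (∀ z ∈ T, ‖z‖ ≤ 1 ∧ ∃ Γ : Finset (Fin n), Γ.card ≤ s ∧ ∀ j ∉ Γ, z j = 0) ∧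
      T.card ≤ (9 * n ^ 2) ^ s ∧
      ∀ Γ : Finset (Fin n), Γ.card ≤ s → ∀ x ∈ unitVectorsOn Γ,
        ∃ z ∈ T, (∀ j ∉ Γ, z j = 0) ∧ ‖x - z‖ ≤ 1 / 4 := by
  classical
  -- Grid of spacing 1/(4s): at most s coordinates give squared error at most s/(4s)² ≤ 1/16. Each
  -- support carries (8s + 1)^s ≤ (9n)^s grid points, since s ≤ n.
  set k : ℕ := 4 * s with hk
  have hk0 : (0 : ℝ) < k := by rw [hk]; positivity
  let g : (Fin n → ℤ) → EuclideanSpace ℝ (Fin n) := fun t => WithLp.toLp 2 fun j => (t j : ℝ) / k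
  have hg : ∀ t j, g t j = (t j : ℝ) / k := fun t j => rfl
  let F : Finset (Fin n) → Finset (Fin n → ℤ) := fun Γ =>
    Fintype.piFinset fun j => if j ∈ Γ then Finset.Icc (-(k : ℤ)) k else {0}
  have hF : ∀ Γ t, t ∈ F Γ ↔ ∀ j, t j ∈ (if j ∈ Γ then Finset.Icc (-(k : ℤ)) k else {0}) :=
    fun Γ t => Fintype.mem_piFinset
  refine ⟨((Finset.powersetCard s Finset.univ).biUnion fun Γ => (F Γ).image g).filter
    (fun z => ‖z‖ ≤ 1), ?_, ?_, ?_, ?_⟩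
  · obtain ⟨Γ, -, hΓ⟩ := Finset.exists_subset_card_eq (s := (Finset.univ : Finset (Fin n)))
      (n := s) (by simpa using hsn)
    simp only [Finset.mem_filter, Finset.mem_biUnion, Finset.mem_powersetCard, Finset.mem_image]
    refine ⟨⟨Γ, ⟨Finset.subset_univ _, hΓ⟩, 0, ?_, ?_⟩, by simp⟩
    · rw [hF]
      intro j
      split_ifs <;> simp
    · ext j; simp [hg]
  · intro z hz
    simp only [Finset.mem_filter, Finset.mem_biUnion, Finset.mem_powersetCard,
      Finset.mem_image] at hz
    obtain ⟨⟨Γ, ⟨-, hΓ⟩, t, ht, rfl⟩, hz1⟩ := hz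
    refine ⟨hz1, Γ, hΓ.le, fun j hj => ?_⟩
    have := (hF Γ t).1 ht j
    rw [if_neg hj, Finset.mem_singleton] at this
    simp [hg, this]
  · refine (Finset.card_filter_le _ _).trans ?_
    refine (Finset.card_biUnion_le_card_mul _ _ ((9 * n) ^ s) fun Γ hΓ => ?_).trans ?_
    · refine Finset.card_image_le.trans ?_
      have hΓ' := (Finset.mem_powersetCard.1 hΓ).2
      have : (F Γ).card = (2 * k + 1) ^ s := by
        rw [Fintype.card_piFinset]
        have : ∀ j, (if j ∈ Γ then Finset.Icc (-(k : ℤ)) k else {0}).card =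
            if j ∈ Γ then 2 * k + 1 else 1 := by
          intro j
          split_ifs
          · rw [Int.card_Icc]; omega
          · simp
        simp only [this]
        rw [Finset.prod_ite_mem, Finset.univ_inter, Finset.prod_const, hΓ']
      rw [this]
      exact Nat.pow_le_pow_left (by omega) s
    · rw [Finset.card_powersetCard, Finset.card_univ, Fintype.card_fin]
      calc n.choose s * (9 * n) ^ s ≤ n ^ s * (9 * n) ^ s :=
            Nat.mul_le_mul_right _ (Nat.choose_le_pow n s)
        _ = _ := by rw [← mul_pow]; ring
  · intro Γ hΓ x hx
    obtain ⟨Γ', hΓΓ', -, hΓ'⟩ := Finset.exists_subsuperset_card_eq (Finset.subset_univ Γ) hΓ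
      (by simpa using hsn)
    choose t ht1 ht2 using fun j => exists_int_abs_le_abs_sub_le (x j * k)
    have ht0 : ∀ j ∉ Γ, t j = 0 := fun j hj => by
      have := ht1 j
      rw [hx.1 j hj, zero_mul, abs_zero] at this
      exact_mod_cast abs_nonpos_iff.1 this
    have hle : ∀ j, |g t j| ≤ |x j| := fun j => by
      rw [hg, abs_div, abs_of_pos hk0, div_le_iff₀ hk0]
      simpa [abs_mul] using ht1 j
    refine ⟨g t, ?_, fun j hj => by simp [hg, ht0 j hj], ?_⟩
    · simp only [Finset.mem_filter, Finset.mem_biUnion, Finset.mem_powersetCard,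
        Finset.mem_image]
      refine ⟨⟨Γ', ⟨Finset.subset_univ _, hΓ'⟩, t, (hF _ _).2 fun j => ?_, rfl⟩, ?_⟩
      · split_ifs with hj
        · have h1 : |(t j : ℝ)| ≤ k := by
            refine (ht1 j).trans ?_
            rw [abs_mul, abs_of_pos hk0]
            have := norm_apply_le x j
            rw [hx.2] at this
            exact mul_le_of_le_one_left hk0.le this
          rw [Finset.mem_Icc, ← abs_le]
          exact_mod_cast h1
        · rw [Finset.mem_singleton]
          exact ht0 j fun h => hj (hΓΓ' h)
      · rw [← hx.2, EuclideanSpace.norm_eq, EuclideanSpace.norm_eq]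
        refine Real.sqrt_le_sqrt (Finset.sum_le_sum fun j _ => ?_)
        have := hle j
        simp only [Real.norm_eq_abs]
        gcongr
    · refine le_of_sq_le_sq ?_ (by norm_num)
      rw [EuclideanSpace.norm_sq_eq]
      calc ∑ j, ‖(x - g t) j‖ ^ 2 = ∑ j ∈ Γ, ‖(x - g t) j‖ ^ 2 := by
            refine (Finset.sum_subset (Finset.subset_univ _) fun j _ hj => ?_).symm
            simp [hg, ht0 j hj, hx.1 j hj]
        _ ≤ ∑ j ∈ Γ, (1 / (k : ℝ)) ^ 2 := by
            refine Finset.sum_le_sum fun j _ => ?_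
            gcongr
            rw [PiLp.sub_apply, hg, Real.norm_eq_abs, le_div_iff₀ hk0]
            calc |x j - t j / k| * k = |x j * k - t j| := by
                  rw [← abs_of_pos hk0, ← abs_mul, abs_of_pos hk0]
                  congr 1; field_simp
              _ ≤ 1 := ht2 j
        _ = Γ.card * (1 / (k : ℝ)) ^ 2 := by simp
        _ ≤ s * (1 / (k : ℝ)) ^ 2 := by gcongr
        _ ≤ (1 / 4) ^ 2 := by
            have h1 : (1 : ℝ) ≤ s := by exact_mod_cast hs
            rw [hk]; push_cast
            rw [div_pow, one_pow, mul_one_div, div_le_iff₀ (by positivity)]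
            nlinarith

/-- Maurey's lemma: a vector of `ℓ¹` norm at most `R` is approximated, in the supremum of the
column forms, by an average of `k` signed multiples of basis vectors. -/
lemma exists_average_columnForms {A : Matrix (Fin n) (Fin m) ℂ} {M R : ℝ}
    (hA : ∀ j i, ‖A j i‖ ≤ M) (hM : 0 ≤ M) (hR : 0 < R) (hn : 0 < n) (hm : 0 < m)
    {k : ℕ} (hk : 0 < k) {x : EuclideanSpace ℝ (Fin n)} (hx : ∑ j, |x j| ≤ R) :
    ∃ f : Fin k → Fin n × Bool, ∀ i,
      ‖columnForms A x i - (∑ a, (if (f a).2 then (R : ℂ) else -R) * A (f a).1 i) / k‖ ≤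
        4 * M * R * √(2 * k * Real.log (4 * m)) / k := by
  have hk' : (0 : ℝ) < k := Nat.cast_pos.2 hk
  have hn' : (0 : ℝ) < n := Nat.cast_pos.2 hn
  have hm' : (1 : ℝ) ≤ m := by exact_mod_cast hm
  let vert : Fin n × Bool → Fin m → ℂ := fun v i => (if v.2 then (R : ℂ) else -R) * A v.1 i
  -- The positive and negative parts of x_j / R weight the vertices ±R e_j. The missing mass is
  -- spread evenly over all 2n vertices, where opposite signs cancel, so the barycentre is still
  -- `x`.
  let w : Fin n × Bool → ℝ := fun v =>
    (1 - (∑ j, |x j|) / R) / (2 * n) + max ((if v.2 then 1 else -1) * x v.1) 0 / R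
  have hw : ∀ v, 0 ≤ w v := fun v => by
    have h1 : (∑ j, |x j|) / R ≤ 1 := (div_le_one hR).2 hx
    have h2 : 0 ≤ 1 - (∑ j, |x j|) / R := by linarith
    have h3 : 0 ≤ max ((if v.2 then 1 else -1) * x v.1) 0 := le_max_right _ _
    positivity
  have habs : ∀ a : ℝ, max a 0 + max (-a) 0 = |a| := fun a => by
    rcases le_total 0 a with h | h
    · rw [abs_of_nonneg h, max_eq_left h, max_eq_right (by linarith), add_zero]
    · rw [abs_of_nonpos h, max_eq_right h, max_eq_left (by linarith), zero_add]
  have hsub : ∀ a : ℝ, max a 0 - max (-a) 0 = a := fun a => by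
    rcases le_total 0 a with h | h
    · rw [max_eq_left h, max_eq_right (by linarith), sub_zero]
    · rw [max_eq_right h, max_eq_left (by linarith)]; ring
  have hw1 : ∑ v, w v = 1 := by
    rw [Fintype.sum_prod_type]
    have : ∀ j, ∑ b, w (j, b) = (1 - (∑ j, |x j|) / R) / n + |x j| / R := fun j => by
      rw [Fintype.sum_bool, ← habs (x j)]
      simp only [w, if_true, Bool.false_eq_true, if_false, one_mul, neg_one_mul]
      field_simp
      ring
    simp only [this]
    have hd : ∑ j, |x j| / R = (∑ j, |x j|) / R := (Finset.sum_div _ _ _).symm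
    rw [Finset.sum_add_distrib, hd]
    simp only [Finset.sum_const, Finset.card_univ, Fintype.card_fin, nsmul_eq_mul]
    field_simp
    ring
  have hbary : ∀ i, ∑ v, (w v : ℂ) * vert v i = columnForms A x i := fun i => by
    rw [Fintype.sum_prod_type, columnForms]
    refine Finset.sum_congr rfl fun j _ => ?_
    have h1 : (w (j, true) - w (j, false)) * R = x j := by
      simp only [w, if_true, Bool.false_eq_true, if_false, one_mul, neg_one_mul]
      rw [add_sub_add_left_eq_sub, ← sub_div, hsub]
      field_simp
    rw [Fintype.sum_bool, ← h1]
    simp only [vert, if_true, Bool.false_eq_true, if_false]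
    push_cast
    ring
  -- Sampling gives one-sided real bounds; four directions recover |Re| and |Im|. The resulting 4m
  -- functionals explain log(4m).
  let θ : Fin 4 → ℂ := ![1, -1, Complex.I, -Complex.I]
  have hθ : ∀ c, ‖θ c‖ = 1 := fun c => by fin_cases c <;> simp [θ]
  let D : Fin m × Fin 4 → Fin n × Bool → ℝ := fun p v =>
    (θ p.2 * (columnForms A x p.1 - vert v p.1)).re
  have hD : ∀ p v, |D p v| ≤ 2 * M * R := fun p v => by
    refine (Complex.abs_re_le_norm _).trans ?_
    rw [norm_mul, hθ, one_mul]
    refine (norm_sub_le _ _).trans ?_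
    have h1 : ‖columnForms A x p.1‖ ≤ M * R :=
      (norm_columnForms_le hA x _).trans (mul_le_mul_of_nonneg_left hx hM)
    have h2 : ‖vert v p.1‖ ≤ R * M := by
      simp only [vert, norm_mul]
      refine mul_le_mul (le_of_eq ?_) (hA _ _) (norm_nonneg _) hR.le
      split_ifs <;> simp [abs_of_pos hR]
    linarith
  have hD0 : ∀ p, ∑ v, w v * D p v = 0 := fun p => by
    have : ∑ v, w v * D p v =
        (θ p.2 * ∑ v, (w v : ℂ) * (columnForms A x p.1 - vert v p.1)).re := by
      rw [Finset.mul_sum, Complex.re_sum]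
      refine Finset.sum_congr rfl fun v _ => ?_
      rw [mul_left_comm, Complex.re_ofReal_mul]
    rw [this]
    simp only [mul_sub]
    rw [Finset.sum_sub_distrib, hbary, ← Finset.sum_mul, ← Complex.ofReal_sum, hw1]
    simp
  have hlog : 0 < Real.log (4 * m) := Real.log_pos (by linarith)
  obtain ⟨f, hf⟩ := exists_sampling hw hw1 (by positivity : 0 ≤ 2 * M * R) hD hD0 hk hlog (by
    rw [Real.exp_log (by positivity)]
    simp [mul_comm])
  refine ⟨f, fun i => ?_⟩
  set E : ℂ := ∑ a, (columnForms A x i - vert (f a) i) with hE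
  set r : ℝ := 2 * M * R * √(2 * k * Real.log (4 * m)) with hr
  have hfE : ∀ c, (θ c * E).re ≤ r := fun c => by
    refine le_trans (le_of_eq ?_) (hf (i, c))
    rw [hE, Finset.mul_sum, Complex.re_sum]
  have h0 := hfE 0
  have h1 := hfE 1
  have h2 := hfE 2
  have h3 := hfE 3
  simp [θ] at h0 h1 h2 h3
  have hEn : ‖E‖ ≤ 2 * r := by
    refine (Complex.norm_le_abs_re_add_abs_im _).trans ?_
    have h4 : |E.re| ≤ r := abs_le.2 ⟨by linarith, h0⟩
    have h5 : |E.im| ≤ r := abs_le.2 ⟨by linarith, h3⟩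
    linarith
  have hk'' : (k : ℂ) ≠ 0 := by exact_mod_cast hk.ne'
  have e : columnForms A x i - (∑ a, (if (f a).2 then (R : ℂ) else -R) * A (f a).1 i) / k
      = E / k := by
    rw [hE, Finset.sum_sub_distrib]
    simp only [Finset.sum_const, Finset.card_univ, Fintype.card_fin, nsmul_eq_mul, vert]
    field_simp
  rw [e, norm_div, Complex.norm_natCast]
  gcongr
  rw [hr] at hEn
  linarith

/-- A finite set of vectors of `ℓ¹` norm at most `R` has a net inside itself, in the supremum of
the column forms, with at most `(2 n) ^ k` elements. -/
lemma exists_projection_columnForms {A : Matrix (Fin n) (Fin m) ℂ} {M R : ℝ}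
    (hA : ∀ j i, ‖A j i‖ ≤ M) (hM : 0 ≤ M) (hR : 0 < R) (hn : 0 < n) (hm : 0 < m)
    {k : ℕ} (hk : 0 < k) (T : Finset (EuclideanSpace ℝ (Fin n)))
    (hT : ∀ x ∈ T, ∑ j, |x j| ≤ R) :
    ∃ p : EuclideanSpace ℝ (Fin n) → EuclideanSpace ℝ (Fin n), (∀ x ∈ T, p x ∈ T) ∧
      (T.image p).card ≤ (2 * n) ^ k ∧ ∀ x ∈ T, ∀ i,
        ‖columnForms A x i - columnForms A (p x) i‖ ≤
          8 * M * R * √(2 * k * Real.log (4 * m)) / k := by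
  classical
  have : Nonempty (Fin n) := ⟨⟨0, hn⟩⟩
  have hex : ∀ x : EuclideanSpace ℝ (Fin n), ∃ f : Fin k → Fin n × Bool, x ∈ T → ∀ i,
      ‖columnForms A x i - (∑ a, (if (f a).2 then (R : ℂ) else -R) * A (f a).1 i) / k‖ ≤
        4 * M * R * √(2 * k * Real.log (4 * m)) / k := fun x => by
    by_cases hx : x ∈ T
    · obtain ⟨f, hf⟩ := exists_average_columnForms hA hM hR hn hm hk (hT x hx)
      exact ⟨f, fun _ => hf⟩
    · exact ⟨Classical.arbitrary _, fun h => absurd h hx⟩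
  choose c hc using hex
  -- Each sampling code in use gets one representative in `T`. Two points with the same code are
  -- within twice Maurey's error, whence 8 in place of 4.
  let g := Function.invFunOn c (T : Set (EuclideanSpace ℝ (Fin n)))
  have hg : ∀ x ∈ T, g (c x) ∈ T ∧ c (g (c x)) = c x := fun x hx =>
    ⟨Function.invFunOn_mem ⟨x, hx, rfl⟩, Function.invFunOn_eq ⟨x, hx, rfl⟩⟩
  refine ⟨fun x => g (c x), fun x hx => (hg x hx).1, ?_, fun x hx i => ?_⟩
  · calc (T.image fun x => g (c x)).card ≤ (Finset.univ.image g).card := by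
          refine Finset.card_le_card fun y hy => ?_
          obtain ⟨x, -, rfl⟩ := Finset.mem_image.1 hy
          exact Finset.mem_image_of_mem _ (Finset.mem_univ _)
      _ ≤ Fintype.card (Fin k → Fin n × Bool) := Finset.card_image_le
      _ = _ := by simp [mul_comm]
  · have h1 := hc x hx i
    have h2 := hc (g (c x)) (hg x hx).1 i
    rw [(hg x hx).2] at h2
    rw [norm_sub_rev] at h2
    refine (norm_sub_le_norm_sub_add_norm_sub _ _ _).trans ((add_le_add h1 h2).trans ?_)
    exact le_of_eq (by ring)

/-- A sequence of nets with geometrically decreasing mesh. -/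
lemma exists_projections_columnForms {A : Matrix (Fin n) (Fin m) ℂ} {M R : ℝ}
    (hA : ∀ j i, ‖A j i‖ ≤ M) (hM : 0 ≤ M) (hR : 0 < R) (hn : 2 ≤ n) (hm : 2 ≤ m)
    (T : Finset (EuclideanSpace ℝ (Fin n))) (hT0 : 0 ∈ T) (hT : ∀ x ∈ T, ∑ j, |x j| ≤ R) :
    ∃ p : ℕ → EuclideanSpace ℝ (Fin n) → EuclideanSpace ℝ (Fin n),
      (∀ l, ∀ x ∈ T, p l x ∈ T) ∧ (∀ x, p 0 x = 0) ∧
      (∀ l, ((T.image (p l)).card : ℝ) ≤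
        Real.exp (4 ^ l * (12 * (Real.log m * Real.log n)))) ∧
      ∀ l, ∀ x ∈ T, ∀ i, ‖columnForms A x i - columnForms A (p l x) i‖ ≤
        12 * M * R / 2 ^ l := by
  classical
  have hn' : (2 : ℝ) ≤ n := by exact_mod_cast hn
  have hm' : (2 : ℝ) ≤ m := by exact_mod_cast hm
  have hlogn : 0 < Real.log n := Real.log_pos (by linarith)
  have hlogm : 0 < Real.log m := Real.log_pos (by linarith)
  set H := Real.log (4 * m) with hH
  have hH1 : 1 ≤ H := by
    rw [hH, Real.le_log_iff_exp_le (by positivity)]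
    linarith [Real.exp_one_lt_d9]
  have hH3 : H ≤ 3 * Real.log m := by
    have h4 : (4 : ℝ) ≤ (m : ℝ) ^ 2 := by nlinarith
    have : (4 * m : ℝ) ≤ (m : ℝ) ^ 3 := by
      rw [pow_succ]; gcongr
    calc H ≤ Real.log ((m : ℝ) ^ 3) := Real.log_le_log (by positivity) this
      _ = _ := by rw [Real.log_pow]; norm_num
  have hn2 : Real.log (2 * n) ≤ 2 * Real.log n := by
    have : (2 * n : ℝ) ≤ (n : ℝ) ^ 2 := by nlinarith
    calc Real.log (2 * n) ≤ Real.log ((n : ℝ) ^ 2) := Real.log_le_log (by positivity) this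
      _ = _ := by rw [Real.log_pow]; norm_num
  -- With k = 4^l K samples, √(2kH)/k ≤ √2/2^l ≤ (3/2)/2^l, and 8 · 3/2 = 12. The entropy is k
  -- log(2n) ≤ 4^l · 6 log m · 2 log n.
  set K := ⌈H⌉₊ with hK
  have hKH : H ≤ K := Nat.le_ceil H
  have hK6 : (K : ℝ) ≤ 6 * Real.log m := by
    have := Nat.ceil_lt_add_one (by linarith : 0 ≤ H)
    linarith
  have hK0 : 0 < K := Nat.ceil_pos.2 (by linarith)
  choose q hq1 hq2 hq3 using fun l : ℕ => exists_projection_columnForms hA hM hR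
    (by omega : 0 < n) (by omega : 0 < m) (by positivity : 0 < 4 ^ l * K) T hT
  -- Level 0 is the zero map, so that the chain starts from the zero process; the trivial bound M R
  -- covers its error.
  refine ⟨fun l => if l = 0 then fun _ => 0 else q l, ?_, by simp, ?_, ?_⟩
  · intro l x hx
    by_cases hl : l = 0
    · simpa [hl] using hT0
    · simpa [hl] using hq1 l x hx
  · intro l
    by_cases hl : l = 0
    · simp only [hl, if_true]
      have h1 : ((T.image fun _ => (0 : EuclideanSpace ℝ (Fin n))).card : ℝ) ≤ 1 := by
        rw [Finset.image_const ⟨0, hT0⟩]; simp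
      exact h1.trans (Real.one_le_exp (by positivity))
    · simp only [hl, if_false]
      calc (((T.image (q l)).card : ℕ) : ℝ) ≤ ((2 * n : ℕ) ^ (4 ^ l * K) : ℕ) := by
            exact_mod_cast hq2 l
        _ = Real.exp ((4 ^ l * K) * Real.log (2 * n)) := by
            push_cast
            rw [← Real.rpow_natCast, Real.rpow_def_of_pos (by positivity)]
            push_cast
            ring_nf
        _ ≤ Real.exp ((4 ^ l * (6 * Real.log m)) * (2 * Real.log n)) := by
            have : 0 ≤ Real.log (2 * n) := Real.log_nonneg (by linarith)
            gcongr
        _ = _ := by ring_nf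
  · intro l x hx i
    by_cases hl : l = 0
    · simp only [hl, if_true, columnForms_zero, Pi.zero_apply, sub_zero, pow_zero, div_one]
      have h1 := (norm_columnForms_le hA x i).trans (mul_le_mul_of_nonneg_left (hT x hx) hM)
      have : 0 ≤ M * R := by positivity
      linarith
    · simp only [hl, if_false]
      refine (hq3 l x hx i).trans ?_
      have hKpos : (0 : ℝ) < K := by exact_mod_cast hK0
      have h1 : √(2 * ((4 ^ l * K : ℕ) : ℝ) * H) ≤ 3 / 2 * (2 ^ l * K) := by
        rw [Real.sqrt_le_left (by positivity)]
        push_cast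
        have e : (4 : ℝ) ^ l = 2 ^ l * 2 ^ l := by rw [← mul_pow]; norm_num
        rw [e]
        have h2 : (2 : ℝ) ^ l * 2 ^ l * K * H ≤ 2 ^ l * 2 ^ l * K * K := by gcongr
        have h3 : (0 : ℝ) ≤ 2 ^ l * 2 ^ l * K * K := by positivity
        nlinarith
      rw [div_le_div_iff₀ (by positivity) (by positivity)]
      push_cast
      push_cast at h1
      have e : (4 : ℝ) ^ l = 2 ^ l * 2 ^ l := by rw [← mul_pow]; norm_num
      calc 8 * M * R * √(2 * (4 ^ l * K) * H) * 2 ^ l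
          ≤ 8 * M * R * (3 / 2 * (2 ^ l * K)) * 2 ^ l := by gcongr
        _ = _ := by rw [e]; ring

end Nets

/-! ### Chaining -/

section Chaining

variable {m : ℕ}

/-- Product rule: p q̄ - p' q̄' splits into (p - p') q̄ and p' times the conjugate of q - q'. In
each term the difference is taken in sup norm and the other factor in ℓ². -/
lemma sum_norm_mul_star_sub_sq_le {p p' q q' : Fin m → ℂ} {δ a b : ℝ} (_hδ : 0 ≤ δ)
    (ha : 0 ≤ a) (hb : 0 ≤ b) (hp : ∀ i, ‖p i - p' i‖ ≤ δ) (hq : ∀ i, ‖q i - q' i‖ ≤ δ)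
    (hqa : ∑ i, ‖q i‖ ^ 2 ≤ a ^ 2) (hpb : ∑ i, ‖p' i‖ ^ 2 ≤ b ^ 2) :
    ∑ i, ‖p i * star (q i) - p' i * star (q' i)‖ ^ 2 ≤ (2 * δ * (a + b)) ^ 2 := by
  have key : ∀ i, ‖p i * star (q i) - p' i * star (q' i)‖ ^ 2 ≤
      2 * δ ^ 2 * ‖q i‖ ^ 2 + 2 * δ ^ 2 * ‖p' i‖ ^ 2 := fun i => by
    have e : p i * star (q i) - p' i * star (q' i) =
        (p i - p' i) * star (q i) + p' i * star (q i - q' i) := by rw [star_sub]; ring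
    have h1 : ‖p i * star (q i) - p' i * star (q' i)‖ ≤ δ * ‖q i‖ + ‖p' i‖ * δ := by
      rw [e]
      refine (norm_add_le _ _).trans ?_
      rw [norm_mul, norm_mul, norm_star, norm_star]
      have := hp i
      have := hq i
      gcongr
    calc _ ≤ (δ * ‖q i‖ + ‖p' i‖ * δ) ^ 2 := by gcongr
      _ ≤ _ := by nlinarith [sq_nonneg (δ * ‖q i‖ - ‖p' i‖ * δ)]
  calc _ ≤ ∑ i, (2 * δ ^ 2 * ‖q i‖ ^ 2 + 2 * δ ^ 2 * ‖p' i‖ ^ 2) :=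
        Finset.sum_le_sum fun i _ => key i
    _ = 2 * δ ^ 2 * ∑ i, ‖q i‖ ^ 2 + 2 * δ ^ 2 * ∑ i, ‖p' i‖ ^ 2 := by
        rw [Finset.sum_add_distrib, Finset.mul_sum, Finset.mul_sum]
    _ ≤ 2 * δ ^ 2 * a ^ 2 + 2 * δ ^ 2 * b ^ 2 := by gcongr
    _ ≤ _ := by
        have h1 : 0 ≤ δ ^ 2 * (a * b) := by positivity
        have h2 : 0 ≤ δ ^ 2 * a ^ 2 := by positivity
        have h3 : 0 ≤ δ ^ 2 * b ^ 2 := by positivity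
        nlinarith

/-- A link of the chain depends on (x, y) only through four projected points, so links are counted
by the sizes of the nets and not by the size of `T`. -/
lemma card_image_prod_le {E F : Type*} [DecidableEq E] [DecidableEq F] (T : Finset E)
    (u u' v v' : E → E) (g : E × E → E × E → F) :
    ((T ×ˢ T).image fun z => g (u z.1, u' z.2) (v z.1, v' z.2)).card ≤
      (T.image u).card * (T.image u').card * ((T.image v).card * (T.image v').card) := by
  rw [← Finset.card_product, ← Finset.card_product, ← Finset.card_product]
  refine le_trans (Finset.card_le_card ?_) (Finset.card_image_le (f := fun r => g r.1 r.2))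
  intro y hy
  obtain ⟨z, hz, rfl⟩ := Finset.mem_image.1 hy
  obtain ⟨h1, h2⟩ := Finset.mem_product.1 hz
  refine Finset.mem_image.2 ⟨((u z.1, u' z.2), (v z.1, v' z.2)), ?_, rfl⟩
  simp only [Finset.mem_product]
  exact ⟨⟨Finset.mem_image_of_mem _ h1, Finset.mem_image_of_mem _ h2⟩,
    Finset.mem_image_of_mem _ h1, Finset.mem_image_of_mem _ h2⟩

set_option maxHeartbeats 1000000 in
/-- The chaining bound for the Rademacher process indexed by pairs of vectors of a finite set. -/
lemma IsRademacher.exists_dominating_pairs {n s : ℕ} (hn : 2 ≤ n) (hm : 2 ≤ m) (hs : 2 ≤ s)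
    {M : ℝ} (hM : 0 ≤ M) {U V : Matrix (Fin n) (Fin m) ℂ}
    (hU : ∀ j i, ‖U j i‖ ≤ M) (hV : ∀ j i, ‖V j i‖ ≤ M)
    {T : Finset (EuclideanSpace ℝ (Fin n))} (hT0 : 0 ∈ T)
    (hT1 : ∀ x ∈ T, ∑ j, |x j| ≤ √(s : ℝ)) (hTcard : T.card ≤ (9 * n ^ 2) ^ s)
    {a b : ℝ} (ha : 0 ≤ a) (hb : 0 ≤ b)
    (hTa : ∀ x ∈ T, ∑ i, ‖columnForms V x i‖ ^ 2 ≤ a ^ 2)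
    (hTb : ∀ x ∈ T, ∑ i, ‖columnForms U x i‖ ^ 2 ≤ b ^ 2)
    {Ω : Type*} [MeasurableSpace Ω] {P : Measure Ω} [IsProbabilityMeasure P]
    {ε : Fin m → Ω → ℝ} (hε : IsRademacher ε P) :
    ∃ Y : Ω → ℝ, Integrable Y P ∧
      ∫ ω, Y ω ∂P ≤ 15000 * M * √(s : ℝ) * Real.log s * √(Real.log m * Real.log n) * (a + b) ∧
      ∀ ω, ∀ x ∈ T, ∀ y ∈ T,
        ‖∑ i, columnForms U y i * star (columnForms V x i) * (ε i ω : ℂ)‖ ≤ Y ω := by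
  classical
  have hn' : (2 : ℝ) ≤ n := by exact_mod_cast hn
  have hm' : (2 : ℝ) ≤ m := by exact_mod_cast hm
  have hs' : (2 : ℝ) ≤ s := by exact_mod_cast hs
  have hlog2 : (0.69 : ℝ) ≤ Real.log 2 := by linarith [Real.log_two_gt_d9]
  have hlogn : 0.69 ≤ Real.log n := hlog2.trans (Real.log_le_log (by norm_num) hn')
  have hlogm : 0.69 ≤ Real.log m := hlog2.trans (Real.log_le_log (by norm_num) hm')
  have hlogs : 0.69 ≤ Real.log s := hlog2.trans (Real.log_le_log (by norm_num) hs')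
  set R : ℝ := √(s : ℝ) with hR
  have hR0 : 0 < R := Real.sqrt_pos.2 (by linarith)
  have hR2 : R ^ 2 = s := Real.sq_sqrt (by linarith)
  set L : ℝ := Real.log m * Real.log n with hL
  have hL0 : 0.47 ≤ L := by nlinarith
  obtain ⟨p, hpT, hp0, hpc, hpd⟩ := exists_projections_columnForms hV hM hR0 hn hm T hT0 hT1
  obtain ⟨q, hqT, hq0, hqc, hqd⟩ := exists_projections_columnForms hU hM hR0 hn hm T hT0 hT1
  let coef : EuclideanSpace ℝ (Fin n) × EuclideanSpace ℝ (Fin n) → Fin m → ℂ :=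
    fun z i => columnForms U z.2 i * star (columnForms V z.1 i)
  set Q : ℝ := M * R * (a + b) with hQ
  have hQ0 : 0 ≤ Q := by positivity
  -- the links of the chain
  have hlink : ∀ l : ℕ, ∃ Y : Ω → ℝ, Integrable Y P ∧ ∫ ω, Y ω ∂P ≤ 3168 * Q * √L ∧
      ∀ ω, ∀ x ∈ T, ∀ y ∈ T,
        ‖∑ i, (coef (p (l + 1) x, q (l + 1) y) i - coef (p l x, q l y) i) * (ε i ω : ℂ)‖
          ≤ Y ω := by
    intro l
    have h4 : (1 : ℝ) ≤ 4 ^ l := one_le_pow₀ (by norm_num)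
    let link : EuclideanSpace ℝ (Fin n) × EuclideanSpace ℝ (Fin n) →
        EuclideanSpace ℝ (Fin n) × EuclideanSpace ℝ (Fin n) → Fin m → ℂ :=
      fun w w' i => coef w i - coef w' i
    let S : Finset (Fin m → ℂ) :=
      (T ×ˢ T).image fun z => link (p (l + 1) z.1, q (l + 1) z.2) (p l z.1, q l z.2)
    -- 120 = 12 · (4 + 4 + 1 + 1): two nets of level l + 1 and two of level l.
    have hcard : (S.card : ℝ) ≤ Real.exp (4 ^ l * (120 * L)) := by
      refine (Nat.cast_le.2 (card_image_prod_le T _ _ _ _ _)).trans ?_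
      push_cast
      calc _ ≤ Real.exp (4 ^ (l + 1) * (12 * L)) * Real.exp (4 ^ (l + 1) * (12 * L)) *
            (Real.exp (4 ^ l * (12 * L)) * Real.exp (4 ^ l * (12 * L))) := by
            gcongr
            exacts [hpc (l + 1), hqc (l + 1), hpc l, hqc l]
        _ = _ := by
            rw [← Real.exp_add, ← Real.exp_add, ← Real.exp_add, pow_succ]
            ring_nf
    have hnorm : ∀ c ∈ S, ∑ i, ‖c i‖ ^ 2 ≤ (48 * Q / 2 ^ l) ^ 2 := by
      intro c hc
      obtain ⟨⟨x, y⟩, hz, rfl⟩ := Finset.mem_image.1 hc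
      obtain ⟨hx, hy⟩ := Finset.mem_product.1 hz
      have hdist : ∀ {A : Matrix (Fin n) (Fin m) ℂ}
          {r : ℕ → EuclideanSpace ℝ (Fin n) → EuclideanSpace ℝ (Fin n)} {x},
          (∀ l i, ‖columnForms A x i - columnForms A (r l x) i‖ ≤ 12 * M * R / 2 ^ l) →
          ∀ i, ‖columnForms A (r (l + 1) x) i - columnForms A (r l x) i‖ ≤
            24 * M * R / 2 ^ l := by
        intro A r x h i
        have h1 := h (l + 1) i
        have h2 := h l i
        rw [norm_sub_rev] at h1
        have h3 : 12 * M * R / 2 ^ (l + 1) ≤ 12 * M * R / 2 ^ l := by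
          gcongr
          · norm_num
          · omega
        calc _ ≤ 12 * M * R / 2 ^ l + 12 * M * R / 2 ^ l :=
              (norm_sub_le_norm_sub_add_norm_sub _ _ _).trans (add_le_add (h1.trans h3) h2)
          _ = _ := by ring
      have := sum_norm_mul_star_sub_sq_le (δ := 24 * M * R / 2 ^ l) (by positivity) ha hb
        (hdist fun l i => hqd l y hy i) (hdist fun l i => hpd l x hx i)
        (hTa _ (hpT (l + 1) x hx)) (hTb _ (hqT l y hy))
      refine this.trans (le_of_eq ?_)
      rw [hQ]
      ring
    obtain ⟨Y, hY1, hY2, hY3⟩ := hε.exists_dominating S (by positivity)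
      (by nlinarith : 1 ≤ 4 ^ l * (120 * L)) hcard hnorm
    refine ⟨Y, hY1, hY2.trans ?_, fun ω x hx y hy => ?_⟩
    · have h1 : √(4 ^ l * (120 * L)) ≤ 2 ^ l * (11 * √L) := by
        rw [Real.sqrt_le_left (by positivity), mul_pow, mul_pow, Real.sq_sqrt (by linarith)]
        have e : ((2 : ℝ) ^ l) ^ 2 = 4 ^ l := by rw [← pow_mul, mul_comm, pow_mul]; norm_num
        rw [e]
        gcongr
        linarith
      calc 6 * (48 * Q / 2 ^ l) * √(4 ^ l * (120 * L))
          ≤ 6 * (48 * Q / 2 ^ l) * (2 ^ l * (11 * √L)) := by gcongr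
        _ = 3168 * Q * √L := by field_simp; ring
    · exact hY3 ω _ (Finset.mem_image.2 ⟨(x, y), Finset.mem_product.2 ⟨hx, hy⟩, rfl⟩)
  choose Y hY1 hY2 hY3 using hlink
  -- Then 2^N > s ≥ √s = R, so the last mesh 12 M R / 2^N is at most 12 M.
  set N : ℕ := Nat.log 2 s + 1 with hN
  have hN2 : (s : ℝ) < 2 ^ N := by exact_mod_cast Nat.lt_pow_succ_log_self (by norm_num) s
  have hNlog : (N : ℝ) ≤ 3 * Real.log s := by
    have h1 : (2 : ℝ) ^ Nat.log 2 s ≤ s := by exact_mod_cast Nat.pow_log_le_self 2 (by omega)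
    have h2 := Real.log_le_log (by positivity) h1
    rw [Real.log_pow] at h2
    have h3 : (Nat.log 2 s : ℝ) * 0.69 ≤ Nat.log 2 s * Real.log 2 := by gcongr
    rw [hN]
    push_cast
    linarith
  -- the last link
  obtain ⟨Z, hZ1, hZ2, hZ3⟩ : ∃ Z : Ω → ℝ, Integrable Z P ∧ ∫ ω, Z ω ∂P ≤ 720 * Q * √L ∧
      ∀ ω, ∀ x ∈ T, ∀ y ∈ T,
        ‖∑ i, (coef (x, y) i - coef (p N x, q N y) i) * (ε i ω : ℂ)‖ ≤ Z ω := by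
    have hT2 : (T.card : ℝ) ≤ Real.exp (s * (6 * Real.log n)) := by
      have h9 : (9 * (n : ℝ) ^ 2) ≤ (n : ℝ) ^ 6 := by
        have h1 : (4 : ℝ) ≤ (n : ℝ) ^ 2 := by nlinarith
        have h2 : (16 : ℝ) ≤ (n : ℝ) ^ 4 := by nlinarith
        nlinarith
      calc (T.card : ℝ) ≤ (9 * (n : ℝ) ^ 2) ^ s := by exact_mod_cast hTcard
        _ ≤ ((n : ℝ) ^ 6) ^ s := by gcongr
        _ = _ := by
            rw [Real.exp_nat_mul, show 6 * Real.log (n : ℝ) = Real.log ((n : ℝ) ^ 6) by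
              rw [Real.log_pow]; norm_num, Real.exp_log (by positivity)]
    let S : Finset (Fin m → ℂ) :=
      (T ×ˢ T).image fun z => fun i => coef z i - coef (p N z.1, q N z.2) i
    have hcard : (S.card : ℝ) ≤ Real.exp (s * (12 * Real.log n)) := by
      refine (Nat.cast_le.2 Finset.card_image_le).trans ?_
      rw [Finset.card_product]
      push_cast
      calc (T.card : ℝ) * T.card ≤ Real.exp (s * (6 * Real.log n)) *
            Real.exp (s * (6 * Real.log n)) := by gcongr
        _ = _ := by rw [← Real.exp_add]; ring_nf
    have hnorm : ∀ c ∈ S, ∑ i, ‖c i‖ ^ 2 ≤ (24 * M * (a + b)) ^ 2 := by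
      intro c hc
      obtain ⟨⟨x, y⟩, hz, rfl⟩ := Finset.mem_image.1 hc
      obtain ⟨hx, hy⟩ := Finset.mem_product.1 hz
      have hδ : 12 * M * R / 2 ^ N ≤ 12 * M := by
        rw [div_le_iff₀ (by positivity)]
        have : R ≤ 2 ^ N := by nlinarith
        gcongr
      have := sum_norm_mul_star_sub_sq_le (δ := 12 * M) (by positivity) ha hb
        (fun i => (hqd N y hy i).trans hδ) (fun i => (hpd N x hx i).trans hδ)
        (hTa x hx) (hTb _ (hqT N y hy))
      refine this.trans (le_of_eq ?_)
      ring
    obtain ⟨Z, hZ1, hZ2, hZ3⟩ := hε.exists_dominating S (by positivity)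
      (by nlinarith : 1 ≤ s * (12 * Real.log n)) hcard hnorm
    refine ⟨Z, hZ1, hZ2.trans ?_, fun ω x hx y hy => ?_⟩
    -- Here √s comes from the entropy of `T` rather than from the mesh; log m ≥ 0.69 lets √L absorb
    -- √(log n).
    · have h1 : √(s * (12 * Real.log n)) ≤ R * (5 * √L) := by
        rw [Real.sqrt_le_left (by positivity), mul_pow, hR2, mul_pow, Real.sq_sqrt (by linarith)]
        refine mul_le_mul_of_nonneg_left ?_ (by positivity)
        rw [hL]
        nlinarith
      calc 6 * (24 * M * (a + b)) * √(s * (12 * Real.log n))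
          ≤ 6 * (24 * M * (a + b)) * (R * (5 * √L)) := by gcongr
        _ = 720 * Q * √L := by rw [hQ]; ring
    · exact hZ3 ω _ (Finset.mem_image.2 ⟨(x, y), Finset.mem_product.2 ⟨hx, hy⟩, rfl⟩)
  refine ⟨fun ω => (∑ l ∈ Finset.range N, Y l ω) + Z ω,
    (integrable_finsetSum _ fun l _ => hY1 l).add hZ1, ?_, fun ω x hx y hy => ?_⟩
  · rw [integral_add (integrable_finsetSum _ fun l _ => hY1 l) hZ1,
      integral_finsetSum _ fun l _ => hY1 l]
    have h1 : ∑ l ∈ Finset.range N, ∫ ω, Y l ω ∂P ≤ N * (3168 * Q * √L) := by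
      refine (Finset.sum_le_sum fun l _ => hY2 l).trans (le_of_eq ?_)
      simp
    have hX : 0 ≤ Q * √L := by positivity
    have h2 : N * (Q * √L) ≤ 3 * Real.log s * (Q * √L) := by gcongr
    have h3 : 1 * (Q * √L) ≤ 2 * Real.log s * (Q * √L) := by
      gcongr
      linarith
    have e : 15000 * M * R * Real.log s * √L * (a + b) = 15000 * (Real.log s * (Q * √L)) := by
      rw [hQ]; ring
    have h4 : 0 ≤ Real.log s * (Q * √L) := by positivity
    rw [e]
    linarith
  · have hzero : ∀ i, coef (p 0 x, q 0 y) i = 0 := fun i => by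
      simp [coef, hp0, hq0, columnForms_zero]
    have hsplit : ∑ i, columnForms U y i * star (columnForms V x i) * (ε i ω : ℂ) =
        (∑ l ∈ Finset.range N, ∑ i,
          (coef (p (l + 1) x, q (l + 1) y) i - coef (p l x, q l y) i) * (ε i ω : ℂ))
        + ∑ i, (coef (x, y) i - coef (p N x, q N y) i) * (ε i ω : ℂ) := by
      rw [Finset.sum_comm, ← Finset.sum_add_distrib]
      refine Finset.sum_congr rfl fun i _ => ?_
      rw [← Finset.sum_mul,
        Finset.sum_range_sub (fun l => coef (p l x, q l y) i), hzero i]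
      ring
    rw [hsplit]
    refine (norm_add_le _ _).trans (add_le_add ?_ (hZ3 ω x hx y hy))
    exact (norm_sum_le _ _).trans (Finset.sum_le_sum fun l _ => hY3 l ω x hx y hy)

/-! ### From the net to the expected sparse norm. -/

lemma sum_abs_le_sqrt {n s : ℕ} {Γ : Finset (Fin n)} (hΓ : Γ.card ≤ s)
    {x : EuclideanSpace ℝ (Fin n)} (hx : ∀ j ∉ Γ, x j = 0) (hx1 : ‖x‖ ≤ 1) :
    ∑ j, |x j| ≤ √(s : ℝ) := by
  refine Real.le_sqrt_of_sq_le ?_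
  have h1 : ∑ j, |x j| = ∑ j ∈ Γ, |x j| :=
    (Finset.sum_subset (Finset.subset_univ _) fun j _ hj => by simp [hx j hj]).symm
  rw [h1]
  refine sq_sum_le_card_mul_sum_sq.trans ?_
  have h2 : ∑ j ∈ Γ, |x j| ^ 2 ≤ 1 := by
    calc ∑ j ∈ Γ, |x j| ^ 2 ≤ ∑ j, |x j| ^ 2 :=
          Finset.sum_le_sum_of_subset_of_nonneg (Finset.subset_univ _) fun _ _ _ => sq_nonneg _
      _ = ‖x‖ ^ 2 := by simp [EuclideanSpace.norm_sq_eq]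
      _ ≤ 1 := pow_le_one₀ (norm_nonneg _) hx1
  calc _ ≤ (s : ℝ) * 1 := by gcongr
    _ = s := mul_one _

/-- The bound on the expected norm when the sparsity does not exceed the dimension. -/
lemma IsRademacher.integral_sparseNorm_le {n s : ℕ} (hn : 2 ≤ n) (hm : 2 ≤ m) (hs : 2 ≤ s)
    (hsn : s ≤ n) {M : ℝ} (hM : 0 ≤ M) {U V : Matrix (Fin n) (Fin m) ℂ}
    (hU : ∀ j i, ‖U j i‖ ≤ M) (hV : ∀ j i, ‖V j i‖ ≤ M)
    {Ω : Type*} [MeasurableSpace Ω] {P : Measure Ω} [IsProbabilityMeasure P]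
    {ε : Fin m → Ω → ℝ} (hε : IsRademacher ε P) :
    ∫ ω, sparseNorm s (U * signMatrix (fun i => ε i ω) * Vᴴ) ∂P ≤
      30000 * M * √(s : ℝ) * Real.log s * √(Real.log m * Real.log n) *
        (√(sparseNorm s (V * Vᴴ)) + √(sparseNorm s (U * Uᴴ))) := by
  obtain ⟨T, hT0, hT1, hTc, hTn⟩ := exists_sparse_net (n := n) (s := s) (by omega) hsn
  have hsq : ∀ A : Matrix (Fin n) (Fin m) ℂ, ∀ x ∈ T,
      ∑ i, ‖columnForms A x i‖ ^ 2 ≤ √(sparseNorm s (A * Aᴴ)) ^ 2 := by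
    intro A x hx
    obtain ⟨h1, Γ, hΓ, hxΓ⟩ := hT1 x hx
    rw [Real.sq_sqrt (sparseNorm_nonneg _ _)]
    exact sum_norm_columnForms_sq_le A hΓ hxΓ h1
  obtain ⟨Y, hY1, hY2, hY3⟩ := hε.exists_dominating_pairs hn hm hs hM hU hV hT0
    (fun x hx => by
      obtain ⟨h1, Γ, hΓ, hxΓ⟩ := hT1 x hx
      exact sum_abs_le_sqrt hΓ hxΓ h1)
    hTc (Real.sqrt_nonneg _) (Real.sqrt_nonneg _) (hsq V) (hsq U)
  have hle : ∀ ω, sparseNorm s (U * signMatrix (fun i => ε i ω) * Vᴴ) ≤ 2 * Y ω := fun ω => by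
    refine sparseNorm_le_of_net _ (T := T) (fun z hz => (hT1 z hz).1) hTn
      ((norm_nonneg _).trans (hY3 ω 0 hT0 0 hT0)) fun x hx y hy => ?_
    rw [dotProduct_mul_signMatrix_mulVec]
    exact hY3 ω x hx y hy
  calc _ ≤ ∫ ω, 2 * Y ω ∂P := by
        refine integral_mono ?_ (hY1.const_mul 2) hle
        exact hε.integrable_comp fun e => sparseNorm s (U * signMatrix e * Vᴴ)
    _ = 2 * ∫ ω, Y ω ∂P := integral_const_mul _ _
    _ ≤ _ := by linarith

end Chaining

theorem mainTheorem5 :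
    ∃ C : ℝ, 0 < C ∧
      ∀ (n m s : ℕ), 2 ≤ n → 2 ≤ m → 2 ≤ s →
      ∀ (M : ℝ) (U V : Matrix (Fin n) (Fin m) ℂ),
        (∀ j i, ‖U j i‖ ≤ M) → (∀ j i, ‖V j i‖ ≤ M) →
      ∀ (Ω : Type*) [MeasurableSpace Ω] (P : Measure Ω) [IsProbabilityMeasure P]
        (ε : Fin m → Ω → ℝ), IsRademacher ε P →
        Integrable (fun ω => sparseNorm s (U * signMatrix (fun i => ε i ω) * Vᴴ)) P ∧
        ∫ ω, sparseNorm s (U * signMatrix (fun i => ε i ω) * Vᴴ) ∂P ≤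
          C * M * √(s : ℝ) * Real.log s * √(Real.log m * Real.log n) *
            (√(sparseNorm s (V * Vᴴ)) + √(sparseNorm s (U * Uᴴ))) := by
  refine ⟨30000, by norm_num, ?_⟩
  intro n m s hn hm hs M U V hU hV Ω _ P _ ε hε
  refine ⟨hε.integrable_comp fun e => sparseNorm s (U * signMatrix e * Vᴴ), ?_⟩
  have hM : 0 ≤ M := (norm_nonneg _).trans (hU ⟨0, by omega⟩ ⟨0, by omega⟩)
  -- The net needs s ≤ n. Replacing s by min s n leaves the sparse norms unchanged and does not
  -- increase the bound.
  have hmin : 2 ≤ min s n := le_min hs hn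
  have h := hε.integral_sparseNorm_le hn hm hmin (min_le_right _ _) hM hU hV
  simp only [sparseNorm_min] at h
  refine h.trans ?_
  have h1 : ((min s n : ℕ) : ℝ) ≤ s := by exact_mod_cast min_le_left s n
  have h2 : (0 : ℝ) < (min s n : ℕ) := by exact_mod_cast (by omega : 0 < min s n)
  have h3 : 0 ≤ Real.log (min s n : ℕ) := Real.log_natCast_nonneg _
  gcongr
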